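/- Let $R$ be a principal ideal domain and $M$ a finite-rank free $R$-module with $\operatorname{rank}(M)\ge 2$. A collection of submodules of $M$ has the *common basis property* if there is a basis $B$ of $M$ such that every member of the collection is spanned by a subset of $B$. Let $T(M)$ be the Tits building (the realization of the poset of proper nonzero direct summands of $M$ under inclusion), let $ST(M)$ be the split Tits building (the realization of the poset of pairs $(P,Q)$ of proper nonzero submodules with $M=P\oplus Q$, where $(P,Q)<(P',Q')$ if $P\subsetneq P'$ and $Q'\subsetneq Q$), and let $CB(M)$ be the common basis complex (vertices the proper nonzero summands of $M$; a nonempty finite set of vertices is a simplex if and only if it has the common basis property). A $p$-simplex $(P_0,Q_0)<\dots<(P_p,Q_p)$ of $ST(M)$ corresponds to the splitting $M=P_0\oplus(P_1\cap Q_0)\oplus\dots\oplus(P_p\cap Q_{p-1})\oplus Q_p$. For a collection $\sigma$ of submodules with the common basis property and integers $a,b\ge 0$, the higher Tits building $T^{a,b}(M,\sigma)$ is the subcomplex of the join of $a$ copies of $T(M)$ and $b$ copies of $ST(M)$ consisting of those simplices for which the collection of all members of their flags, all summands of their splittings and all members of $\sigma$ has the common basis property. Write $T(M,\sigma)=T^{1,0}(M,\sigma)$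 and $ST(M,\sigma)=T^{0,1}(M,\sigma)$. Let $\tau=\{V_0\subsetneq\dots\subsetneq V_p\}$ be a nonempty simplex of $T(M)$, and let $\sigma$ be a simplex of $CB(M)$ containing $\tau$. Let $\tau_1,\dots,\tau_r$, $r\ge 2$, be pairwise distinct simplices of $ST(M,\sigma)$ in the preimage of $\tau$ under the map $ST(M,\sigma)\to T(M,\sigma)$, $(P,Q)\mapsto P$. Let $\sigma_i$ be the union of $\sigma$ and the set of all submodules $P,Q$ occurring in the vertices $(P,Q)$ of $\tau_i$. Then $$T(M,\sigma_1)\cap\dots\cap T(M,\sigma_r)$$ is contractible, and, for all integers $a\ge 1$ and $b\ge 0$, $$T^{a,b}(M,\sigma_1)\cap\dots\cap T^{a,b}(M,\sigma_r)$$ is contractible. -/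

import Mathlib

namespace HigherTits

universe u v

/-! ### Geometric realization of an abstract simplicial complex -/

section Realization

variable {ι : Type u}

/-- The closed simplex `|s|` spanned by a finite vertex set `s`, in barycentric coordinates. -/
def closedSimplex (s : Finset ι) : Set (ι → ℝ) :=
  {x | (∀ i, 0 ≤ x i) ∧ (∀ i, i ∉ s → x i = 0) ∧ ∑ i ∈ s, x i = 1}

/-- The points of the geometric realization of a simplicial complex `K`: barycentric coordinates
supported on a face of `K`. -/
def Realization (K : PreAbstractSimplicialComplex ι) : Type u :=
  {x : ι → ℝ // ∃ s ∈ K.faces, x ∈ closedSimplex s}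

/-- The inclusion of the closed simplex of a face into the realization. -/
def Realization.incl (K : PreAbstractSimplicialComplex ι) (s : K.faces) :
    closedSimplex (s : Finset ι) → Realization K :=
  fun x => ⟨x, s, s.2, x.2⟩

/-- The weak (CW) topology: a subset of the realization is open exactly when its trace on each
closed simplex is open, closed simplices carrying their Euclidean topology. -/
instance (K : PreAbstractSimplicialComplex ι) : TopologicalSpace (Realization K) :=
  ⨆ s : K.faces, TopologicalSpace.coinduced (Realization.incl K s) inferInstance

end Realization

section Modules

variable {R : Type u} {M : Type v} [CommRing R] [AddCommGroup M] [Module R M]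

/-! ### The common basis property -/

/-- `U` is spanned by a subset of `B`. -/
def SpannedBySubset (B : Set M) (U : Submodule R M) : Prop :=
  ∃ A ⊆ B, Submodule.span R A = U

/-- A collection `S` of submodules of `M` has the common basis property: there is a basis `B` of
`M` such that every member of `S` is spanned by a subset of `B`. -/
def HasCommonBasis (S : Set (Submodule R M)) : Prop :=
  ∃ B : Set M, LinearIndepOn R id B ∧ Submodule.span R B = ⊤ ∧ ∀ U ∈ S, SpannedBySubset B U

theorem HasCommonBasis.mono {S T : Set (Submodule R M)} (hT : HasCommonBasis T) (h : S ⊆ T) :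
    HasCommonBasis S := by
  obtain ⟨B, h1, h2, h3⟩ := hT
  exact ⟨B, h1, h2, fun U hU => h3 U (h hU)⟩

theorem SpannedBySubset.sup {B : Set M} {U V : Submodule R M} (hU : SpannedBySubset B U)
    (hV : SpannedBySubset B V) : SpannedBySubset B (U ⊔ V) := by
  obtain ⟨A, hA, rfl⟩ := hU
  obtain ⟨A', hA', rfl⟩ := hV
  exact ⟨A ∪ A', Set.union_subset hA hA', Submodule.span_union _ _⟩

theorem SpannedBySubset.inf {B : Set M} (hB : LinearIndepOn R id B) {U V : Submodule R M}
    (hU : SpannedBySubset B U) (hV : SpannedBySubset B V) : SpannedBySubset B (U ⊓ V) := by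
  obtain ⟨A, hA, rfl⟩ := hU
  obtain ⟨A', hA', rfl⟩ := hV
  refine ⟨A ∩ A', Set.inter_subset_left.trans hA, ?_⟩
  have hd : Disjoint A (A' \ A) := Set.disjoint_sdiff_right
  have hi : LinearIndepOn R id (A ∪ A' \ A) :=
    hB.mono (Set.union_subset hA (Set.sdiff_subset.trans hA'))
  have hdis : Disjoint (Submodule.span R A) (Submodule.span R (A' \ A)) :=
    ((linearIndepOn_id_union_iff hd).1 hi).2.2
  have hsp : Submodule.span R A' =
      Submodule.span R (A ∩ A') ⊔ Submodule.span R (A' \ A) := by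
    rw [← Submodule.span_union]
    congr 1
    ext x
    by_cases hx : x ∈ A <;> simp [hx]
  have hle : Submodule.span R (A ∩ A') ≤ Submodule.span R A :=
    Submodule.span_mono Set.inter_subset_left
  rw [hsp, inf_comm, sup_inf_assoc_of_le _ hle, inf_comm, hdis.eq_bot, sup_bot_eq]

variable (R M)

/-! ### Vertices -/

/-- Proper nonzero split submodules of `M`, ordered by inclusion: the vertices of the Tits building
`T(M)` and of the common basis complex `CB(M)`. -/
abbrev ProperSummand : Type v :=
  {U : Submodule R M // U ≠ ⊥ ∧ U ≠ ⊤ ∧ IsComplemented U}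

/-- Splittings `M = P ⊕ Q` of size two with `P` and `Q` proper and nonzero: the vertices of the
split Tits building `ST(M)`. -/
@[ext]
structure Splitting where
  fst : Submodule R M
  snd : Submodule R M
  isCompl : IsCompl fst snd
  fst_ne_bot : fst ≠ ⊥
  snd_ne_bot : snd ≠ ⊥

variable {R M}

namespace Splitting

/-- `(P, Q) ≤ (P', Q')` when `P ⊆ P'` and `Q' ⊆ Q`. -/
instance : PartialOrder (Splitting R M) where
  le x y := x.fst ≤ y.fst ∧ y.snd ≤ x.snd
  le_refl _ := ⟨le_rfl, le_rfl⟩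
  le_trans _ _ _ h h' := ⟨h.1.trans h'.1, h'.2.trans h.2⟩
  le_antisymm _ _ h h' := Splitting.ext (le_antisymm h.1 h'.1) (le_antisymm h'.2 h.2)

theorem le_def {x y : Splitting R M} : x ≤ y ↔ x.fst ≤ y.fst ∧ y.snd ≤ x.snd := Iff.rfl

theorem lt_def {x y : Splitting R M} : x < y ↔ x.fst < y.fst ∧ y.snd < x.snd := by
  constructor
  · intro h
    obtain ⟨h1, h2⟩ := h.le
    refine ⟨lt_of_le_of_ne h1 fun e => h.ne ?_, lt_of_le_of_ne h2 fun e => h.ne ?_⟩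
    · refine Splitting.ext e (le_antisymm ?_ h2)
      have : x.snd = y.snd ⊔ y.fst ⊓ x.snd := by
        rw [← sup_inf_assoc_of_le _ h2, sup_comm, y.isCompl.sup_eq_top, top_inf_eq]
      rw [this, ← e, x.isCompl.inf_eq_bot, sup_bot_eq]
    · refine Splitting.ext (le_antisymm h1 ?_) e.symm
      have : y.fst = x.fst ⊔ x.snd ⊓ y.fst := by
        rw [← sup_inf_assoc_of_le _ h1, x.isCompl.sup_eq_top, top_inf_eq]
      rw [this, ← e, inf_comm, y.isCompl.inf_eq_bot, sup_bot_eq]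
  · intro h
    exact lt_of_le_not_ge ⟨h.1.le, h.2.le⟩ fun h' => h.1.not_ge h'.1

theorem fst_ne_top (x : Splitting R M) : x.fst ≠ ⊤ := fun h =>
  x.snd_ne_bot (by simpa [h] using x.isCompl.inf_eq_bot)

/-- The vertex map `(P, Q) ↦ P` of the map `ST(M) → T(M)` that forgets complements. -/
def forget (x : Splitting R M) : ProperSummand R M :=
  ⟨x.fst, x.fst_ne_bot, x.fst_ne_top, x.snd, x.isCompl⟩

end Splitting

/-- All the submodules `P`, `Q` that occur in the vertices `(P, Q)` of `t`. -/
def components (t : Set (Splitting R M)) : Set (Submodule R M) :=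
  {U | ∃ x ∈ t, U = x.fst ∨ U = x.snd}

/-- The summands `P₀, P₁ ∩ Q₀, …, P_p ∩ Q_{p-1}, Q_p` of the splitting of `M` of size `p + 2` that
corresponds to the simplex `t = {(P₀, Q₀) < ⋯ < (P_p, Q_p)}` of `ST(M)` (none if `t` is empty). -/
def splittingPieces (t : Set (Splitting R M)) : Set (Submodule R M) :=
  {U | (∃ x, IsLeast t x ∧ U = x.fst) ∨
    (∃ x ∈ t, ∃ y ∈ t, x < y ∧ (∀ z ∈ t, ¬ (x < z ∧ z < y)) ∧ U = y.fst ⊓ x.snd) ∨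
    (∃ x, IsGreatest t x ∧ U = x.snd)}

/-- A basis is adapted to the summands of a splitting exactly when it is adapted to all the
submodules in the corresponding simplex of `ST(M)`. -/
theorem forall_splittingPieces_iff {B : Set M} (hB : LinearIndepOn R id B)
    {t : Set (Splitting R M)} (ht : IsChain (· ≤ ·) t) (hf : t.Finite) :
    (∀ U ∈ splittingPieces t, SpannedBySubset B U) ↔
      ∀ U ∈ components t, SpannedBySubset B U := by
  constructor
  · intro h
    have hcmp : ∀ x ∈ t, ∀ y ∈ t, ¬ x ≤ y → y < x := by
      intro x hx y hy hxy
      rcases ht.total hx hy with h' | h'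
      · exact absurd h' hxy
      · exact lt_of_le_not_ge h' hxy
    have h1 : ∀ x ∈ t, SpannedBySubset B x.fst := by
      intro x hx
      refine Set.WellFoundedOn.induction (r := (· < ·)) (P := fun x => SpannedBySubset B x.fst)
        hf.wellFoundedOn hx ?_
      intro x hx ih
      by_cases hl : ∀ y ∈ t, x ≤ y
      · exact h _ (Or.inl ⟨x, ⟨hx, fun y hy => hl y hy⟩, rfl⟩)
      · push Not at hl
        obtain ⟨y₀, hy₀, hxy₀⟩ := hl
        obtain ⟨y, hy⟩ := (hf.subset (Set.sep_subset t (· < x))).exists_maximal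
          ⟨y₀, hy₀, hcmp x hx y₀ hy₀ hxy₀⟩
        have hle := hy.prop.2.le.1
        have : x.fst = y.fst ⊔ x.fst ⊓ y.snd := by
          rw [inf_comm, ← sup_inf_assoc_of_le _ hle, y.isCompl.sup_eq_top, top_inf_eq]
        rw [this]
        refine (ih y hy.prop.1 hy.prop.2).sup (h _ (Or.inr (Or.inl
          ⟨y, hy.prop.1, x, hx, hy.prop.2, ?_, rfl⟩)))
        rintro z hz ⟨hyz, hzx⟩
        exact hyz.not_ge (hy.le_of_ge ⟨hz, hzx⟩ hyz.le)
    have h2 : ∀ x ∈ t, SpannedBySubset B x.snd := by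
      intro x hx
      refine Set.WellFoundedOn.induction (r := (· > ·)) (P := fun x => SpannedBySubset B x.snd)
        hf.wellFoundedOn hx ?_
      intro x hx ih
      by_cases hl : ∀ y ∈ t, y ≤ x
      · exact h _ (Or.inr (Or.inr ⟨x, ⟨hx, fun y hy => hl y hy⟩, rfl⟩))
      · push Not at hl
        obtain ⟨y₀, hy₀, hxy₀⟩ := hl
        obtain ⟨y, hy⟩ := (hf.subset (Set.sep_subset t (x < ·))).exists_minimal
          ⟨y₀, hy₀, hcmp y₀ hy₀ x hx hxy₀⟩
        have hle := hy.prop.2.le.2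
        have : x.snd = y.snd ⊔ y.fst ⊓ x.snd := by
          rw [← sup_inf_assoc_of_le _ hle, sup_comm, y.isCompl.sup_eq_top, top_inf_eq]
        rw [this]
        refine (ih y hy.prop.1 hy.prop.2).sup (h _ (Or.inr (Or.inl
          ⟨x, hx, y, hy.prop.1, hy.prop.2, ?_, rfl⟩)))
        rintro z hz ⟨hxz, hzy⟩
        exact hzy.not_ge (hy.le_of_le ⟨hz, hxz⟩ hzy.le)
    rintro U ⟨x, hx, rfl | rfl⟩
    exacts [h1 x hx, h2 x hx]
  · rintro h U (⟨x, hx, rfl⟩ | ⟨x, hx, y, hy, -, -, rfl⟩ | ⟨x, hx, rfl⟩)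
    · exact h _ ⟨x, hx.1, Or.inl rfl⟩
    · exact (h _ ⟨y, hy, Or.inl rfl⟩).inf hB (h _ ⟨x, hx, Or.inr rfl⟩)
    · exact h _ ⟨x, hx.1, Or.inr rfl⟩

theorem components_mono {s t : Set (Splitting R M)} (h : s ⊆ t) : components s ⊆ components t := by
  rintro U ⟨x, hx, hU⟩
  exact ⟨x, h hx, hU⟩

theorem components_pieces_spanned {B : Set M} (hB : LinearIndepOn R id B)
    {s t : Set (Splitting R M)} (ht : IsChain (· ≤ ·) t) (hf : t.Finite) (hst : s ⊆ t)
    (h : ∀ U ∈ splittingPieces t, SpannedBySubset B U) :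
    ∀ U ∈ splittingPieces s, SpannedBySubset B U :=
  (forall_splittingPieces_iff hB (ht.mono hst) (hf.subset hst)).2 fun U hU =>
    (forall_splittingPieces_iff hB ht hf).1 h U (components_mono hst hU)

/-! ### The complexes -/

variable (R M) in
/-- The Tits building `T(M)`: the order complex of the poset of proper nonzero split submodules;
its simplices are the nonempty finite flags. -/
def titsBuilding : PreAbstractSimplicialComplex (ProperSummand R M) where
  faces := {s | s.Nonempty ∧ IsChain (· ≤ ·) (s : Set (ProperSummand R M))}
  isRelLowerSet_faces := fun _ hs =>
    ⟨hs.1, fun _ hts ht => ⟨ht, hs.2.mono (Finset.coe_subset.2 hts)⟩⟩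

variable (R M) in
/-- The common basis complex `CB(M)`. -/
def commonBasisComplex : PreAbstractSimplicialComplex (ProperSummand R M) where
  faces := {s | s.Nonempty ∧
    HasCommonBasis (Subtype.val '' (s : Set (ProperSummand R M)))}
  isRelLowerSet_faces := fun _ hs =>
    ⟨hs.1, fun _ hts ht => ⟨ht, hs.2.mono (Set.image_mono (Finset.coe_subset.2 hts))⟩⟩

/-- The relative Tits building `T(M, σ)`: flags that, together with `σ`, have a common basis. -/
def relTits (σ : Set (Submodule R M)) : PreAbstractSimplicialComplex (ProperSummand R M) where
  faces := {s | s ∈ (titsBuilding R M).faces ∧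
    HasCommonBasis (Subtype.val '' (s : Set (ProperSummand R M)) ∪ σ)}
  isRelLowerSet_faces := fun _ hs =>
    ⟨hs.1.1, fun _ hts ht => ⟨((titsBuilding R M).isRelLowerSet_faces hs.1).2 hts ht,
      hs.2.mono (Set.union_subset_union_left _ (Set.image_mono (Finset.coe_subset.2 hts)))⟩⟩

variable (R M) in
/-- The split Tits building `ST(M)`: the order complex of the poset of splittings. -/
def splitTitsBuilding : PreAbstractSimplicialComplex (Splitting R M) where
  faces := {s | s.Nonempty ∧ IsChain (· ≤ ·) (s : Set (Splitting R M))}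
  isRelLowerSet_faces := fun _ hs =>
    ⟨hs.1, fun _ hts ht => ⟨ht, hs.2.mono (Finset.coe_subset.2 hts)⟩⟩

/-- The relative split Tits building `ST(M, σ)`: simplices of `ST(M)` whose associated splitting of
`M` has, together with `σ`, a common basis. -/
def relSplitTits (σ : Set (Submodule R M)) : PreAbstractSimplicialComplex (Splitting R M) where
  faces := {s | s ∈ (splitTitsBuilding R M).faces ∧
    HasCommonBasis (splittingPieces (s : Set (Splitting R M)) ∪ σ)}
  isRelLowerSet_faces := by
    rintro s ⟨hs, B, h1, h2, h3⟩
    refine ⟨hs.1, fun t hts ht =>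
      ⟨((splitTitsBuilding R M).isRelLowerSet_faces hs).2 hts ht, B, h1, h2, ?_⟩⟩
    rintro U (hU | hU)
    · exact components_pieces_spanned h1 hs.2 s.finite_toSet (Finset.coe_subset.2 hts)
        (fun V hV => h3 V (Or.inl hV)) U hU
    · exact h3 U (Or.inr hU)

variable (R M) in
/-- The vertices of the join of `a` copies of `T(M)` and `b` copies of `ST(M)`. -/
abbrev JoinVertex (a b : ℕ) : Type v :=
  (Fin a × ProperSummand R M) ⊕ (Fin b × Splitting R M)

/-- The part of a set of join vertices that lies in the `i`th factor `T(M)`. -/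
def flagPart {a b : ℕ} (s : Set (JoinVertex R M a b)) (i : Fin a) : Set (ProperSummand R M) :=
  {V | Sum.inl (i, V) ∈ s}

/-- The part of a set of join vertices that lies in the `j`th factor `ST(M)`. -/
def splitPart {a b : ℕ} (s : Set (JoinVertex R M a b)) (j : Fin b) : Set (Splitting R M) :=
  {x | Sum.inr (j, x) ∈ s}

theorem splitPart_finite {a b : ℕ} (s : Finset (JoinVertex R M a b)) (j : Fin b) :
    (splitPart (s : Set (JoinVertex R M a b)) j).Finite :=
  s.finite_toSet.preimage fun x _ y _ h => by simpa using h

/-- The join `T(M) * ⋯ * T(M) * ST(M) * ⋯ * ST(M)` of `a` copies of `T(M)` and `b` copies of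
`ST(M)`: a nonempty finite set of vertices is a simplex when its part in each factor is a simplex
of that factor or empty, that is, a chain. -/
def joinComplex (R : Type u) (M : Type v) [CommRing R] [AddCommGroup M] [Module R M] (a b : ℕ) :
    PreAbstractSimplicialComplex (JoinVertex R M a b) where
  faces := {s | s.Nonempty ∧
    (∀ i, IsChain (· ≤ ·) (flagPart (s : Set (JoinVertex R M a b)) i)) ∧
    (∀ j, IsChain (· ≤ ·) (splitPart (s : Set (JoinVertex R M a b)) j))}
  isRelLowerSet_faces := fun _ hs => ⟨hs.1, fun _ hts ht =>
    ⟨ht, fun i => (hs.2.1 i).mono fun _ hV => hts hV, fun j => (hs.2.2 j).mono fun _ hV => hts hV⟩⟩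

/-- The submodules carried by a simplex of the join: the members of its flags and the summands of
its splittings. -/
def joinModules {a b : ℕ} (s : Set (JoinVertex R M a b)) : Set (Submodule R M) :=
  (⋃ i, Subtype.val '' flagPart s i) ∪ ⋃ j, splittingPieces (splitPart s j)

/-- The higher Tits building `T^{a,b}(M, σ)` relative to `σ`: simplices of the join whose
submodules have, together with `σ`, a common basis. -/
def higherTits (a b : ℕ) (σ : Set (Submodule R M)) :
    PreAbstractSimplicialComplex (JoinVertex R M a b) where
  faces := {s | s ∈ (joinComplex R M a b).faces ∧
    HasCommonBasis (joinModules (s : Set (JoinVertex R M a b)) ∪ σ)}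
  isRelLowerSet_faces := by
    rintro s ⟨hs, B, h1, h2, h3⟩
    refine ⟨hs.1, fun t hts ht =>
      ⟨((joinComplex R M a b).isRelLowerSet_faces hs).2 hts ht, B, h1, h2, ?_⟩⟩
    rintro U ((hU | hU) | hU)
    · obtain ⟨i, V, hV, rfl⟩ := Set.mem_iUnion.1 hU
      exact h3 _ (Or.inl (Or.inl (Set.mem_iUnion.2 ⟨i, V, hts hV, rfl⟩)))
    · obtain ⟨j, hj⟩ := Set.mem_iUnion.1 hU
      exact components_pieces_spanned h1 (hs.2.2 j) (splitPart_finite s j) (fun _ hV => hts hV)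
        (fun V hV => h3 V (Or.inl (Or.inr (Set.mem_iUnion.2 ⟨j, hV⟩)))) U hj
    · exact h3 U (Or.inr hU)

/-- `T(M, σ)` is `T^{1,0}(M, σ)`. -/
theorem map_mem_higherTits_one_zero_iff {σ : Set (Submodule R M)}
    {s : Finset (ProperSummand R M)} :
    s.map ⟨fun V => (Sum.inl (0, V) : JoinVertex R M 1 0), fun V W h => by simpa using h⟩ ∈
      (higherTits 1 0 σ).faces ↔ s ∈ (relTits σ).faces := by
  have h : ∀ i, flagPart (↑(s.map ⟨fun V => (Sum.inl (0, V) : JoinVertex R M 1 0),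
      fun V W h => by simpa using h⟩) : Set (JoinVertex R M 1 0)) i = ↑s := by
    intro i
    obtain rfl := Subsingleton.elim i 0
    ext V
    simp only [flagPart, Finset.coe_map, Set.mem_ofPred_eq]
    exact ⟨by rintro ⟨W, hW, e⟩; cases e; exact hW, fun hV => ⟨V, hV, rfl⟩⟩
  simp only [higherTits, relTits, joinComplex, titsBuilding, joinModules, Set.mem_ofPred_eq, h, Set.iUnion_const]
  simp

/-- `ST(M, σ)` is `T^{0,1}(M, σ)`. -/
theorem map_mem_higherTits_zero_one_iff {σ : Set (Submodule R M)}
    {s : Finset (Splitting R M)} :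
    s.map ⟨fun x => (Sum.inr (0, x) : JoinVertex R M 0 1), fun V W h => by simpa using h⟩ ∈
      (higherTits 0 1 σ).faces ↔ s ∈ (relSplitTits σ).faces := by
  have h : ∀ j, splitPart (↑(s.map ⟨fun x => (Sum.inr (0, x) : JoinVertex R M 0 1),
      fun V W h => by simpa using h⟩) : Set (JoinVertex R M 0 1)) j = ↑s := by
    intro j
    obtain rfl := Subsingleton.elim j 0
    ext x
    simp only [splitPart, Finset.coe_map, Set.mem_ofPred_eq]
    exact ⟨by rintro ⟨W, hW, e⟩; cases e; exact hW, fun hx => ⟨x, hx, rfl⟩⟩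
  simp only [higherTits, relSplitTits, joinComplex, splitTitsBuilding, joinModules,
    Set.mem_ofPred_eq, h, Set.iUnion_const]
  simp

/-- The collection `σ_i` obtained by adding to `σ` all the submodules `P`, `Q` that occur in the
vertices `(P, Q)` of the simplex `t` of `ST(M)`. -/
def addSplitFlag (σ : Finset (ProperSummand R M)) (t : Finset (Splitting R M)) :
    Set (Submodule R M) :=
  Subtype.val '' (σ : Set (ProperSummand R M)) ∪ components (t : Set (Splitting R M))

/-- The collection `σ_i` has a common basis when `t` is a simplex of `ST(M, σ)`. -/
theorem hasCommonBasis_addSplitFlag {σ : Finset (ProperSummand R M)} {t : Finset (Splitting R M)}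
    (ht : t ∈ (relSplitTits (Subtype.val '' (σ : Set (ProperSummand R M)))).faces) :
    HasCommonBasis (addSplitFlag σ t) := by
  obtain ⟨hc, B, h1, h2, h3⟩ := ht
  refine ⟨B, h1, h2, ?_⟩
  rintro U (hU | hU)
  · exact h3 U (Or.inr hU)
  · exact (forall_splittingPieces_iff h1 hc.2 t.finite_toSet).1 (fun V hV => h3 V (Or.inl hV)) U hU

end Modules

end HigherTits

/-!
The intersections are contracted to a vertex `V` of the flag `τ` by explicit straight lines.

Since two of the lifts differ, some `V` in `τ` has different complements `Q` and `Q'` in them. Two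
complements of `V` adapted to a common basis that is also adapted to `V` are equal
(`Adapted.eq_of_isCompl`), so a vertex `U` of the intersection, being compatible with `V` and `Q`
and with `V` and `Q'`, is never a complement of `V` (`not_isCompl_of_two_complements`).

A point of the realization assigns masses to the members of a flag. It determines a weight function
on `M`: the weight of `m` is the total mass of the members that contain `m`. The masses are
recovered as gaps: the mass of `U` is the length of the set of thresholds `l` for which the vectors
of weight more than `l` span `U` (`gap_pushWeight_zero`). The straight line from this function to
the indicator function of `V` therefore describes a path in the realization that ends at `V`: at
each time the level submodules form a flag, and they are adapted to every basis that is adapted to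
the original flag and to `V` (`Dominated.adapted_level`). So a single path stays in all the
complexes that are intersected, although each of them uses bases of its own. Vertices outside of the
chosen copy of `T(M)` just have their masses scaled down to zero, and the result is normalized.
Normalization could fail only where the weight function is constant, which happens only on the way
from a complement of `V` (`pushTotal_pos`); this case has been excluded.

On an adapted basis a gap is a difference of a minimum and a maximum of weights, so the homotopy is
continuous on each closed simplex (`continuous_gap`). This is enough for continuity in the weak
topology, because the image of a closed simplex meets finitely many vertices
(`Realization.contractibleSpace_of_homotopy`).

The argument applies to `T(M, σ)` and to `T^{a,b}(M, σ)` with `a ≥ 1` through their common features,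
`IsFlagComplex`.
-/

namespace HigherTits

open Set MeasureTheory Module

/-! ### Homotopies on the realization of a simplicial complex -/

section Topology

open unitInterval

variable {ι : Type*}

theorem isClosed_closedSimplex (s : Finset ι) : IsClosed (closedSimplex s) := by
  have h : closedSimplex s = (⋂ i, {x : ι → ℝ | 0 ≤ x i}) ∩
      (⋂ i, ⋂ _ : i ∉ s, {x : ι → ℝ | x i = 0}) ∩ {x : ι → ℝ | ∑ i ∈ s, x i = 1} := by
    ext x
    simp [closedSimplex, and_assoc]
  rw [h]
  refine ((isClosed_iInter fun i => isClosed_le continuous_const (continuous_apply i)).inter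
    (isClosed_iInter fun i => isClosed_iInter fun _ =>
      isClosed_eq (continuous_apply i) continuous_const)).inter
    (isClosed_eq (continuous_finsetSum _ fun i _ => continuous_apply i) continuous_const)

theorem Realization.continuous_incl (K : PreAbstractSimplicialComplex ι) (s : K.faces) :
    Continuous (Realization.incl K s) :=
  continuous_iff_coinduced_le.2 (le_iSup (fun s : K.faces =>
    TopologicalSpace.coinduced (Realization.incl K s) inferInstance) s)

/-- A map into a realization that meets only finitely many vertices is continuous as soon as its
barycentric coordinates are: a finite subcomplex carries the Euclidean topology, being a finite
union of closed simplices. -/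
theorem Realization.continuous_of_finite_support {K : PreAbstractSimplicialComplex ι}
    {Z : Type*} [TopologicalSpace Z] (f : Z → Realization K) (S : Finset ι)
    (hS : ∀ z, ∀ i ∉ S, (f z).1 i = 0) (hf : ∀ i, Continuous fun z => (f z).1 i) :
    Continuous f := by
  classical
  have hc : Continuous fun z => (f z).1 := continuous_pi hf
  have : Finite {t : Finset ι // t ∈ K.faces ∧ t ⊆ S} :=
    (S.powerset.finite_toSet.subset fun t ht => Finset.mem_powerset.2 ht.2).to_subtype
  refine (locallyFinite_of_finite fun t : {t : Finset ι // t ∈ K.faces ∧ t ⊆ S} =>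
    {z | (f z).1 ∈ closedSimplex t.1}).continuous ?_ ?_ ?_
  · refine eq_univ_of_forall fun z => mem_iUnion.2 ?_
    obtain ⟨s, hs, hz⟩ := (f z).2
    have hsum : ∑ i ∈ s ∩ S, (f z).1 i = 1 := by
      rw [← hz.2.2]
      refine Finset.sum_subset Finset.inter_subset_left fun i hi hi' => hS z i fun h => hi' ?_
      exact Finset.mem_inter.2 ⟨hi, h⟩
    refine ⟨⟨s ∩ S, (K.isRelLowerSet_faces hs).2 Finset.inter_subset_left ?_,
      Finset.inter_subset_right⟩, hz.1, fun i hi => ?_, hsum⟩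
    · rw [Finset.nonempty_iff_ne_empty]
      intro h
      simp [h] at hsum
    · by_cases h : i ∈ S
      · exact hz.2.1 i fun h' => hi (Finset.mem_inter.2 ⟨h', h⟩)
      · exact hS z i h
  · exact fun t => (isClosed_closedSimplex t.1).preimage hc
  · intro t
    rw [continuousOn_iff_continuous_domRestrict]
    exact (Realization.continuous_incl K ⟨t.1, t.2.1⟩).comp
      (Continuous.subtype_mk (hc.comp continuous_subtype_val) fun z => z.2)

/-- A homotopy on a realization may be checked one closed simplex at a time, since the unit
interval is locally compact. -/
theorem Realization.continuous_uncurry {K : PreAbstractSimplicialComplex ι}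
    {Y : Type*} [TopologicalSpace Y] (H : Realization K → I → Y)
    (hH : ∀ s : K.faces, Continuous fun p : closedSimplex (s : Finset ι) × I =>
      H (Realization.incl K s p.1) p.2) :
    Continuous fun p : Realization K × I => H p.1 p.2 := by
  have hx : ∀ x, Continuous (H x) := by
    rintro ⟨x, s, hs, hxs⟩
    exact (hH ⟨s, hs⟩).comp (Continuous.prodMk (continuous_const (y := ⟨x, hxs⟩)) continuous_id)
  have h : Continuous fun x : Realization K => (⟨H x, hx x⟩ : C(I, Y)) := by
    refine continuous_iSup_dom.2 fun s => continuous_coinduced_dom.2 ?_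
    exact ((⟨_, hH s⟩ : C(closedSimplex (s : Finset ι) × I, Y)).curry).continuous
  exact ContinuousMap.continuous_uncurry_of_continuous ⟨_, h⟩

/-- A coordinatewise criterion for contractibility of a realization. -/
theorem Realization.contractibleSpace_of_homotopy {K : PreAbstractSimplicialComplex ι}
    (H : Realization K → I → Realization K) (y : Realization K)
    (h0 : ∀ x, H x 0 = x) (h1 : ∀ x, H x 1 = y)
    (hfin : ∀ s ∈ K.faces, ∃ S : Finset ι, ∀ x : Realization K, x.1 ∈ closedSimplex s →
      ∀ t, ∀ i ∉ S, (H x t).1 i = 0)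
    (hcont : ∀ s : K.faces, ∀ i, Continuous fun p : closedSimplex (s : Finset ι) × I =>
      (H (Realization.incl K s p.1) p.2).1 i) :
    ContractibleSpace (Realization K) := by
  rw [contractible_iff_id_nullhomotopic]
  refine ⟨y, ⟨⟨⟨fun p => H p.2 p.1, ?_⟩, h0, h1⟩⟩⟩
  refine (Realization.continuous_uncurry H fun s => ?_).comp continuous_swap
  obtain ⟨S, hS⟩ := hfin s s.2
  exact Realization.continuous_of_finite_support _ S
    (fun p i hi => hS (Realization.incl K s p.1) p.1.2 p.2 i hi) (hcont s)

end Topology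

/-! ### Level submodules and gaps of a weight function -/

section Gap

variable {R M κ : Type*} [CommRing R] [AddCommGroup M] [Module R M]

/-- `U` is adapted to the basis `b`: with each element it contains all the basis vectors that occur
in its expansion. Equivalently, `U` is spanned by members of `b`. -/
def Adapted (b : Basis κ R M) (U : Submodule R M) : Prop :=
  ∀ m ∈ U, ∀ k ∈ (b.repr m).support, b k ∈ U

theorem Adapted.eq_span {b : Basis κ R M} {U : Submodule R M} (hU : Adapted b U) :
    U = Submodule.span R (b '' {k | b k ∈ U}) := by
  refine le_antisymm (fun m hm => ?_) (Submodule.span_le.2 ?_)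
  · exact b.mem_span_image.2 fun k hk => hU m hm k hk
  · rintro _ ⟨k, hk, rfl⟩
    exact hk

theorem adapted_span (b : Basis κ R M) (A : Set κ) :
    Adapted b (Submodule.span R (b '' A)) := fun _ hm k hk =>
  Submodule.subset_span ⟨k, b.mem_span_image.1 hm hk, rfl⟩

theorem Adapted.spannedBySubset {b : Basis κ R M} {U : Submodule R M} (hU : Adapted b U) :
    SpannedBySubset (range b) U :=
  ⟨_, image_subset_range _ _, hU.eq_span.symm⟩

theorem Adapted.of_spannedBySubset {b : Basis κ R M} {U : Submodule R M}
    (hU : SpannedBySubset (range b) U) : Adapted b U := by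
  obtain ⟨A, hA, rfl⟩ := hU
  obtain ⟨A', rfl⟩ := subset_range_iff_exists_image_eq.1 hA
  exact adapted_span b A'

theorem Adapted.exists_mem {b : Basis κ R M} {U : Submodule R M} (hU : Adapted b U)
    (h : U ≠ ⊥) : ∃ k, b k ∈ U := by
  by_contra! hk
  refine h ?_
  rw [hU.eq_span]
  simp [hk]

theorem exists_notMem_of_ne_top (b : Basis κ R M) {U : Submodule R M} (h : U ≠ ⊤) :
    ∃ k, b k ∉ U := by
  by_contra! hk
  refine h (top_le_iff.1 ?_)
  rw [← b.span_eq]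
  exact Submodule.span_le.2 (range_subset_iff.2 hk)

theorem basis_mem_span_image_iff [Nontrivial R] (b : Basis κ R M) {A : Set κ} {k : κ} :
    b k ∈ Submodule.span R (b '' A) ↔ k ∈ A := by
  rw [b.mem_span_image, b.repr_self, Finsupp.support_single _ one_ne_zero]
  simp

theorem span_image_eq_bot_iff [Nontrivial R] (b : Basis κ R M) {A : Set κ} :
    Submodule.span R (b '' A) = ⊥ ↔ A = ∅ := by
  constructor
  · intro h
    by_contra hne
    obtain ⟨k, hk⟩ := nonempty_iff_ne_empty.2 hne
    exact b.ne_zero k (Submodule.span_eq_bot.1 h _ ⟨k, hk, rfl⟩)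
  · rintro rfl
    simp

theorem span_image_eq_top_iff [Nontrivial R] (b : Basis κ R M) {A : Set κ} :
    Submodule.span R (b '' A) = ⊤ ↔ A = univ := by
  constructor
  · intro h
    refine eq_univ_of_forall fun k => ?_
    exact (basis_mem_span_image_iff b).1 (h ▸ Submodule.mem_top)
  · rintro rfl
    rw [image_univ, b.span_eq]

theorem Adapted.isComplemented {b : Basis κ R M} {U : Submodule R M} (hU : Adapted b U) :
    IsComplemented U := by
  refine ⟨Submodule.span R (b '' {k | b k ∉ U}), Submodule.disjoint_def.2 fun m hm hm' => ?_, ?_⟩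
  · have : (b.repr m).support = ∅ := Finset.eq_empty_of_forall_notMem fun k hk =>
      b.mem_span_image.1 hm' hk (hU m hm k hk)
    simpa using this
  · rw [codisjoint_iff, eq_top_iff, ← b.span_eq, Submodule.span_le]
    rintro _ ⟨k, rfl⟩
    by_cases hk : b k ∈ U
    · exact Submodule.mem_sup_left hk
    · exact Submodule.mem_sup_right (Submodule.subset_span ⟨k, hk, rfl⟩)

theorem Adapted.isCompl {b : Basis κ R M} {U V : Submodule R M} (hU : Adapted b U)
    (hV : Adapted b V) (h1 : ∀ k, ¬ (b k ∈ U ∧ b k ∈ V)) (h2 : ∀ k, b k ∈ U ∨ b k ∈ V) :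
    IsCompl U V := by
  refine ⟨Submodule.disjoint_def.2 fun m hm hm' => ?_, ?_⟩
  · have : (b.repr m).support = ∅ := Finset.eq_empty_of_forall_notMem fun k hk =>
      h1 k ⟨hU m hm k hk, hV m hm' k hk⟩
    simpa using this
  · rw [codisjoint_iff, eq_top_iff, ← b.span_eq, Submodule.span_le]
    rintro _ ⟨k, rfl⟩
    exact (h2 k).elim (fun h => Submodule.mem_sup_left h) fun h => Submodule.mem_sup_right h

/-- Within the submodules adapted to one basis complements are unique. -/
theorem Adapted.eq_of_isCompl [Nontrivial R] {b : Basis κ R M} {U V Q : Submodule R M}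
    (hU : Adapted b U) (hV : Adapted b V) (hQ : Adapted b Q) (hVU : IsCompl V U)
    (hVQ : IsCompl V Q) : U = Q := by
  have key : ∀ {P : Submodule R M}, Adapted b P → IsCompl V P → ∀ k, b k ∈ P ↔ b k ∉ V := by
    intro P hP h k
    refine ⟨fun hk hk' => b.ne_zero k (Submodule.disjoint_def.1 h.disjoint _ hk' hk), fun hk => ?_⟩
    have ht : Submodule.span R (b '' ({k | b k ∈ V} ∪ {k | b k ∈ P})) = ⊤ := by
      rw [image_union, Submodule.span_union, ← hV.eq_span, ← hP.eq_span, h.sup_eq_top]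
    have := (span_image_eq_top_iff b).1 ht
    exact ((this ▸ mem_univ k : k ∈ {k | b k ∈ V} ∪ {k | b k ∈ P})).resolve_left hk
  rw [hU.eq_span, hQ.eq_span]
  congr 2
  ext k
  simp only [mem_ofPred_eq, key hU hVU, key hQ hVQ]

/-- The submodule spanned by the vectors of weight more than `l`. -/
def level (R : Type*) {M : Type*} [CommRing R] [AddCommGroup M] [Module R M] (φ : M → ℝ) (l : ℝ) :
    Submodule R M :=
  Submodule.span R {m | l < φ m}

/-- The length of the set of those thresholds at which the level submodule of `φ` is `U`. -/
noncomputable def gap (φ : M → ℝ) (U : Submodule R M) : ℝ :=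
  volume.real {l | level R φ l = U}

theorem level_anti (φ : M → ℝ) : Antitone (level R φ) := fun _ _ h =>
  Submodule.span_mono fun _ hm => h.trans_lt hm

theorem gap_nonneg (φ : M → ℝ) (U : Submodule R M) : 0 ≤ gap φ U := measureReal_nonneg

theorem exists_level_eq_of_gap_ne_zero {φ : M → ℝ} {U : Submodule R M} (h : gap φ U ≠ 0) :
    ∃ l, level R φ l = U := by
  by_contra! hl
  exact h (by simp [gap, hl])

/-- The weight of a vector is at most that of each basis vector in its expansion. Then the level
submodules are adapted to the basis. -/
def Dominated (b : Basis κ R M) (φ : M → ℝ) : Prop :=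
  ∀ m, ∀ k ∈ (b.repr m).support, φ m ≤ φ (b k)

variable {b : Basis κ R M} {φ : M → ℝ}

theorem Dominated.level_eq (h : Dominated b φ) (l : ℝ) :
    level R φ l = Submodule.span R (b '' {k | l < φ (b k)}) := by
  refine le_antisymm (Submodule.span_le.2 fun m hm => ?_) (Submodule.span_mono ?_)
  · exact b.mem_span_image.2 fun k hk => lt_of_lt_of_le hm (h m k hk)
  · rintro _ ⟨k, hk, rfl⟩
    exact hk

theorem Dominated.adapted_level (h : Dominated b φ) (l : ℝ) : Adapted b (level R φ l) :=
  h.level_eq l ▸ adapted_span b _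

theorem Dominated.mem_level_iff [Nontrivial R] (h : Dominated b φ) {l : ℝ} {k : κ} :
    b k ∈ level R φ l ↔ l < φ (b k) := by
  rw [h.level_eq]
  exact basis_mem_span_image_iff b

theorem Dominated.gap_eq_zero (h : Dominated b φ) {U : Submodule R M} (hU : ¬ Adapted b U) :
    gap φ U = 0 := by
  by_contra h0
  obtain ⟨l, rfl⟩ := exists_level_eq_of_gap_ne_zero h0
  exact hU (h.adapted_level l)

theorem Dominated.level_eq_iff [Nontrivial R] (h : Dominated b φ) {U : Submodule R M}
    (hU : Adapted b U) {l : ℝ} :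
    level R φ l = U ↔ (∀ k, b k ∈ U → l < φ (b k)) ∧ ∀ k, b k ∉ U → φ (b k) ≤ l := by
  constructor
  · rintro rfl
    exact ⟨fun k hk => h.mem_level_iff.1 hk, fun k hk => not_lt.1 (mt h.mem_level_iff.2 hk)⟩
  · rintro ⟨h1, h2⟩
    rw [h.level_eq, hU.eq_span]
    congr 2
    ext k
    exact ⟨fun hk => by_contra fun hk' => (h2 k hk').not_gt hk, h1 k⟩

open Classical in
/-- The thresholds with level submodule `U` form the interval from the largest weight of a basis
vector outside of `U` to the smallest weight of one in `U`; it may be empty. -/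
theorem Dominated.setOf_level_eq [Nontrivial R] [Fintype κ] (h : Dominated b φ) {U : Submodule R M}
    (hU : Adapted b U) (hin : (Finset.univ.filter fun k => b k ∈ U).Nonempty)
    (hout : (Finset.univ.filter fun k => b k ∉ U).Nonempty) :
    {l | level R φ l = U} = Ico ((Finset.univ.filter fun k => b k ∉ U).sup' hout (φ ∘ b))
      ((Finset.univ.filter fun k => b k ∈ U).inf' hin (φ ∘ b)) := by
  ext l
  simp only [mem_ofPred_eq, h.level_eq_iff hU, mem_Ico, Finset.sup'_le_iff, Finset.lt_inf'_iff,
    Finset.mem_filter, Finset.mem_univ, true_and, Function.comp_apply]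
  exact and_comm

theorem Adapted.filter_nonempty [Fintype κ] {U : Submodule R M} (hU : Adapted b U) (h0 : U ≠ ⊥)
    [DecidablePred fun k => b k ∈ U] : (Finset.univ.filter fun k => b k ∈ U).Nonempty := by
  obtain ⟨k, hk⟩ := hU.exists_mem h0
  exact ⟨k, by simpa using hk⟩

theorem filter_notMem_nonempty [Fintype κ] (b : Basis κ R M) {U : Submodule R M} (h : U ≠ ⊤)
    [DecidablePred fun k => b k ∉ U] : (Finset.univ.filter fun k => b k ∉ U).Nonempty := by
  obtain ⟨k, hk⟩ := exists_notMem_of_ne_top b h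
  exact ⟨k, by simpa using hk⟩

/-- Gaps depend continuously on the weights of the vectors of an adapted basis. -/
theorem continuous_gap [Nontrivial R] [Finite κ] {Z : Type*} [TopologicalSpace Z]
    {φ : Z → M → ℝ} (h : ∀ z, Dominated b (φ z)) (hφ : ∀ k, Continuous fun z => φ z (b k))
    {U : Submodule R M} (h0 : U ≠ ⊥) (h1 : U ≠ ⊤) : Continuous fun z => gap (φ z) U := by
  classical
  have := Fintype.ofFinite κ
  by_cases hU : Adapted b U
  · have hin := hU.filter_nonempty h0
    have hout := filter_notMem_nonempty b h1
    have e : ∀ z, gap (φ z) U = max ((Finset.univ.filter fun k => b k ∈ U).inf' hin (φ z ∘ b) -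
        (Finset.univ.filter fun k => b k ∉ U).sup' hout (φ z ∘ b)) 0 := by
      intro z
      rw [gap]
      convert! Real.volume_real_Ico using 2
      convert! (h z).setOf_level_eq hU hin hout
    simp only [e]
    refine Continuous.max (Continuous.sub ?_ ?_) continuous_const
    · exact Continuous.finset_inf'_apply hin fun k _ => hφ k
    · exact Continuous.finset_sup'_apply hout fun k _ => hφ k
  · simp only [fun z => (h z).gap_eq_zero hU]
    exact continuous_const

theorem Dominated.le_gap [Nontrivial R] [Finite κ] (h : Dominated b φ) {U : Submodule R M}
    (hU : Adapted b U) (h0 : U ≠ ⊥) (h1 : U ≠ ⊤) {c d : ℝ} (hc : ∀ k, b k ∈ U → c ≤ φ (b k))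
    (hd : ∀ k, b k ∉ U → φ (b k) ≤ d) : c - d ≤ gap φ U := by
  classical
  have := Fintype.ofFinite κ
  have hin := hU.filter_nonempty h0
  have hout := filter_notMem_nonempty b h1
  rw [gap, h.setOf_level_eq hU hin hout, Real.volume_real_Ico]
  refine le_max_of_le_left (sub_le_sub ?_ ?_)
  · exact Finset.le_inf' _ _ fun k hk => hc k (by simpa using hk)
  · exact Finset.sup'_le _ _ fun k hk => hd k (by simpa using hk)

/-- The proper level submodules partition the interval from the least to the greatest weight. -/
theorem Dominated.sum_gap [Nontrivial R] [Fintype κ] [Nonempty κ] (h : Dominated b φ)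
    (S : Finset (ProperSummand R M)) (hS : ∀ U : ProperSummand R M, Adapted b U.1 → U ∈ S) :
    ∑ U ∈ S, gap φ U.1 = Finset.univ.sup' Finset.univ_nonempty (φ ∘ b) -
      Finset.univ.inf' Finset.univ_nonempty (φ ∘ b) := by
  classical
  have hmem : ∀ l : ℝ, l ∈ Ico (Finset.univ.inf' Finset.univ_nonempty (φ ∘ b))
      (Finset.univ.sup' Finset.univ_nonempty (φ ∘ b)) ↔
        level R φ l ≠ ⊥ ∧ level R φ l ≠ ⊤ := by
    intro l
    simp only [mem_Ico, Finset.inf'_le_iff, Finset.lt_sup'_iff, Finset.mem_univ, true_and,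
      Function.comp_apply, ne_eq, h.level_eq, span_image_eq_bot_iff, span_image_eq_top_iff,
      eq_empty_iff_forall_notMem, eq_univ_iff_forall, mem_ofPred_eq]
    push Not
    exact and_comm
  have hunion : (⋃ U ∈ S, {l | level R φ l = U.1}) =
      Ico (Finset.univ.inf' Finset.univ_nonempty (φ ∘ b))
        (Finset.univ.sup' Finset.univ_nonempty (φ ∘ b)) := by
    ext l
    rw [hmem]
    simp only [mem_iUnion, mem_ofPred_eq, exists_prop]
    constructor
    · rintro ⟨U, -, hU⟩
      exact hU ▸ ⟨U.2.1, U.2.2.1⟩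
    · rintro ⟨h0, h1⟩
      exact ⟨⟨_, h0, h1, (h.adapted_level l).isComplemented⟩, hS _ (h.adapted_level l), rfl⟩
  have hIco : ∀ U : ProperSummand R M, ∃ x y : ℝ, {l | level R φ l = U.1} = Ico x y := by
    intro U
    by_cases hU : Adapted b U.1
    · exact ⟨_, _, h.setOf_level_eq hU (hU.filter_nonempty U.2.1) (filter_notMem_nonempty b U.2.2.1)⟩
    · refine ⟨0, 0, ?_⟩
      rw [Ico_self]
      exact eq_empty_of_forall_notMem fun l hl => hU (hl ▸ h.adapted_level l)
  have hle : Finset.univ.inf' Finset.univ_nonempty (φ ∘ b) ≤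
      Finset.univ.sup' Finset.univ_nonempty (φ ∘ b) := by
    obtain ⟨k⟩ := ‹Nonempty κ›
    exact (Finset.inf'_le _ (Finset.mem_univ k)).trans (Finset.le_sup' _ (Finset.mem_univ k))
  rw [← Real.volume_real_Ico_of_le hle, ← hunion, measureReal_biUnion_finset ?_ ?_ ?_]
  · rfl
  · intro U _ W _ hUW
    refine disjoint_left.2 fun l hl hl' => hUW (Subtype.ext ?_)
    exact Eq.trans (Eq.symm hl) hl'
  · intro U _
    obtain ⟨x, y, e⟩ := hIco U
    rw [e]
    exact measurableSet_Ico
  · intro U _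
    obtain ⟨x, y, e⟩ := hIco U
    rw [e]
    exact measure_Ico_lt_top.ne

theorem finite_setOf_adapted [Finite κ] (b : Basis κ R M) :
    {U : ProperSummand R M | Adapted b U.1}.Finite := by
  refine Finite.of_injOn (f := fun U : ProperSummand R M => {k | b k ∈ U.1})
    (t := univ) (mapsTo_univ _ _) ?_ (toFinite _)
  intro U hU W hW h
  refine Subtype.ext ?_
  have h' : {k | b k ∈ U.1} = {k | b k ∈ W.1} := h
  rw [Adapted.eq_span hU, Adapted.eq_span hW, h']

end Gap

/-! ### Pushing a complex of flags towards a summand -/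

section Push

open unitInterval

variable {R : Type*} {M : Type*} {ι : Type*} [CommRing R] [AddCommGroup M] [Module R M]

/-- The weight of a vector `m` at the point with barycentric coordinates `x`: the total coordinate
of those vertices `e U` for which `m ∈ U`. The sum is finite if `x` lies in a closed simplex and `e`
is injective. -/
noncomputable def weight (e : ProperSummand R M → ι) (x : ι → ℝ) (m : M) : ℝ :=
  open Classical in ∑ᶠ U : ProperSummand R M, if m ∈ U.1 then x (e U) else 0

/-- The weight function at time `t` on the straight line from `weight e x` to the indicator
function of `V`. -/
noncomputable def pushWeight (e : ProperSummand R M → ι) (V : Submodule R M) (x : ι → ℝ) (t : ℝ)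
    (m : M) : ℝ :=
  open Classical in (1 - t) * weight e x m + t * if m ∈ V then 1 else 0

/-- The homogeneous coordinates of the point reached at time `t`: the gaps of the weight function
at the vertices `e U`, and the coordinates of `x`, scaled down linearly, at all other vertices. -/
noncomputable def pushCoord (e : ProperSummand R M → ι) (V : Submodule R M) (x : ι → ℝ) (t : ℝ) :
    ι → ℝ :=
  Function.extend e (fun U => gap (pushWeight e V x t) U.1) fun i => (1 - t) * x i

/-- The sum of all homogeneous coordinates. Only finitely many of them are nonzero if `x` lies in a
closed simplex that has an adapted basis, see `pushTotal_eq_sum`. -/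
noncomputable def pushTotal (e : ProperSummand R M → ι) (V : Submodule R M) (x : ι → ℝ) (t : ℝ) :
    ℝ :=
  ∑ᶠ i, pushCoord e V x t i

variable {e : ProperSummand R M → ι} {V : Submodule R M} {s : Finset ι} {x : ι → ℝ} {t : ℝ}

open Classical in
theorem weight_eq_sum (he : Function.Injective e) (hx : x ∈ closedSimplex s) (m : M) :
    weight e x m = ∑ U ∈ s.preimage e he.injOn, if m ∈ U.1 then x (e U) else 0 := by
  refine finsum_eq_sum_of_support_subset _ fun U hU => ?_
  by_contra hs
  refine hU ?_
  have : x (e U) = 0 := hx.2.1 _ fun h => hs (by simpa using h)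
  simp [this]

theorem pushCoord_apply (he : Function.Injective e) (U : ProperSummand R M) :
    pushCoord e V x t (e U) = gap (pushWeight e V x t) U.1 :=
  he.extend_apply _ _ _

theorem pushCoord_of_notMem {i : ι} (hi : i ∉ range e) :
    pushCoord e V x t i = (1 - t) * x i :=
  Function.extend_apply' _ _ _ hi

theorem pushCoord_nonneg (he : Function.Injective e) (hx : x ∈ closedSimplex s) (ht : t ∈ I)
    (i : ι) : 0 ≤ pushCoord e V x t i := by
  by_cases hi : i ∈ range e
  · obtain ⟨U, rfl⟩ := hi
    rw [pushCoord_apply he]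
    exact gap_nonneg _ _
  · rw [pushCoord_of_notMem hi]
    exact mul_nonneg (sub_nonneg.2 ht.2) (hx.1 i)

variable {κ : Type*} {b : Basis κ R M}

theorem dominated_pushWeight (he : Function.Injective e) (hx : x ∈ closedSimplex s) (ht : t ∈ I)
    (hs : ∀ U, e U ∈ s → Adapted b U.1) (hV : Adapted b V) :
    Dominated b (pushWeight e V x t) := by
  classical
  intro m k hk
  refine add_le_add (mul_le_mul_of_nonneg_left ?_ (sub_nonneg.2 ht.2))
    (mul_le_mul_of_nonneg_left ?_ ht.1)
  · rw [weight_eq_sum he hx, weight_eq_sum he hx]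
    refine Finset.sum_le_sum fun U hU => ?_
    have := hx.1 (e U)
    by_cases hm : m ∈ U.1
    · simp [hm, hs U (by simpa using hU) m hm k hk]
    · simp only [hm, if_false]
      split_ifs <;> simp [this]
  · by_cases hm : m ∈ V
    · simp [hm, hV m hm k hk]
    · simp only [hm, if_false]
      split_ifs <;> simp

open Classical in
/-- The vertices that can carry mass when a point of the simplex `s` is pushed. -/
noncomputable def pushSupport [Finite κ] (b : Basis κ R M) (e : ProperSummand R M → ι)
    (s : Finset ι) : Finset ι :=
  (finite_setOf_adapted b).toFinset.image e ∪ s.filter (· ∉ range e)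

theorem pushCoord_eq_zero [Finite κ] (he : Function.Injective e) (hx : x ∈ closedSimplex s)
    (ht : t ∈ I) (hs : ∀ U, e U ∈ s → Adapted b U.1) (hV : Adapted b V) {i : ι}
    (hi : i ∉ pushSupport b e s) : pushCoord e V x t i = 0 := by
  simp only [pushSupport, Finset.mem_union, Finset.mem_image, Finite.mem_toFinset,
    mem_ofPred_eq, Finset.mem_filter, not_or, not_exists, not_and, not_not] at hi
  by_cases hi' : i ∈ range e
  · obtain ⟨U, rfl⟩ := hi'
    rw [pushCoord_apply he]
    exact (dominated_pushWeight he hx ht hs hV).gap_eq_zero fun hU => hi.1 U hU rfl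
  · rw [pushCoord_of_notMem hi', hx.2.1 i fun h => hi' (hi.2 h), mul_zero]

theorem pushTotal_eq_sum [Finite κ] (he : Function.Injective e) (hx : x ∈ closedSimplex s)
    (ht : t ∈ I) (hs : ∀ U, e U ∈ s → Adapted b U.1) (hV : Adapted b V) :
    pushTotal e V x t = ∑ i ∈ pushSupport b e s, pushCoord e V x t i :=
  finsum_eq_sum_of_support_subset _ fun _ hi =>
    by_contra fun h => hi (pushCoord_eq_zero he hx ht hs hV h)

open Classical in
theorem pushTotal_eq [Finite κ] (he : Function.Injective e) (hx : x ∈ closedSimplex s)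
    (ht : t ∈ I) (hs : ∀ U, e U ∈ s → Adapted b U.1) (hV : Adapted b V) :
    pushTotal e V x t =
      ∑ U ∈ (finite_setOf_adapted b).toFinset, gap (pushWeight e V x t) U.1 +
        (1 - t) * ∑ i ∈ s.filter (· ∉ range e), x i := by
  rw [pushTotal_eq_sum he hx ht hs hV, pushSupport, Finset.sum_union, Finset.sum_image,
    Finset.mul_sum]
  · congr 1
    · exact Finset.sum_congr rfl fun U _ => pushCoord_apply he U
    · exact Finset.sum_congr rfl fun i hi => pushCoord_of_notMem (Finset.mem_filter.1 hi).2
  · exact he.injOn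
  · refine Finset.disjoint_left.2 fun i hi hi' => (Finset.mem_filter.1 hi').2 ?_
    obtain ⟨U, -, rfl⟩ := Finset.mem_image.1 hi
    exact mem_range_self U

open Classical in
theorem sum_preimage_add_sum (he : Function.Injective e) (hx : x ∈ closedSimplex s) :
    ∑ U ∈ s.preimage e he.injOn, x (e U) + ∑ i ∈ s.filter (· ∉ range e), x i = 1 := by
  rw [← hx.2.2, ← Finset.sum_filter_add_sum_filter_not s (· ∈ range e)]
  congr 1
  exact Finset.sum_preimage' e s he.injOn x

/-- At time `0` nothing has moved. Every gap is at least the corresponding coordinate, and both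
families have the same sum. -/
theorem gap_pushWeight_zero [Nontrivial R] [Nontrivial M] [Finite κ] (he : Function.Injective e)
    (hx : x ∈ closedSimplex s) (hs : ∀ U, e U ∈ s → Adapted b U.1) (hV : Adapted b V)
    (hc : IsChain (· ≤ ·) (e ⁻¹' (s : Set ι))) (U : ProperSummand R M) :
    gap (pushWeight e V x 0) U.1 = x (e U) := by
  classical
  have := Fintype.ofFinite κ
  have : Nonempty κ := b.index_nonempty
  have hdom : Dominated b (pushWeight e V x 0) :=
    dominated_pushWeight he hx ⟨le_rfl, zero_le_one⟩ hs hV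
  set F := s.preimage e he.injOn with hF
  have hmemF : ∀ {W}, W ∈ F ↔ e W ∈ s := by simp [hF]
  have hw : ∀ m, pushWeight e V x 0 m = ∑ W ∈ F, if m ∈ W.1 then x (e W) else 0 := by
    intro m
    simp [pushWeight, weight_eq_sum he hx, hF]
  have hge : ∀ W : ProperSummand R M, x (e W) ≤ gap (pushWeight e V x 0) W.1 := by
    intro W
    by_cases hW : e W ∈ s
    · -- Basis vectors in `W` carry at least the mass of the members containing `W`, those outside
      -- of `W` at most that of the members strictly larger; these differ by the mass of `W`.
      have hcd : x (e W) = ∑ U ∈ F, (if W ≤ U then x (e U) else 0) -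
          ∑ U ∈ F, (if W < U then x (e U) else 0) := by
        rw [← Finset.sum_sub_distrib, Finset.sum_eq_single W]
        · simp
        · intro U _ hne
          simp [lt_iff_le_and_ne, hne.symm]
        · exact fun h => absurd (hmemF.2 hW) h
      rw [hcd]
      refine hdom.le_gap (hs W hW) W.2.1 W.2.2.1 (fun k hk => ?_) fun k hk => ?_
      · rw [hw]
        refine Finset.sum_le_sum fun U _ => ?_
        have := hx.1 (e U)
        by_cases hWU : W ≤ U
        · simp [hWU, (show W.1 ≤ U.1 from hWU) hk]
        · simp only [hWU, if_false]
          split_ifs <;> simp [this]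
      · rw [hw]
        refine Finset.sum_le_sum fun U hU => ?_
        have := hx.1 (e U)
        by_cases hkU : b k ∈ U.1
        · have hlt : W < U := by
            rcases hc.total (x := W) (y := U) hW (hmemF.1 hU) with h | h
            · exact lt_of_le_of_ne h fun h => hk (h ▸ hkU)
            · exact absurd ((show U.1 ≤ W.1 from h) hkU) hk
          simp [hkU, hlt]
        · simp only [hkU, if_false]
          split_ifs <;> simp [this]
    · rw [hx.2.1 _ hW]
      exact gap_nonneg _ _
  set S := (finite_setOf_adapted b).toFinset with hS
  have hmemS : ∀ {W : ProperSummand R M}, W ∈ S ↔ Adapted b W.1 := by simp [hS]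
  have hsum : ∑ W ∈ S, gap (pushWeight e V x 0) W.1 ≤ ∑ W ∈ S, x (e W) := by
    have hFS : ∑ W ∈ F, x (e W) = ∑ W ∈ S, x (e W) :=
      Finset.sum_subset (fun W hW => hmemS.2 (hs W (hmemF.1 hW)))
        fun W _ hW => hx.2.1 _ fun h => hW (hmemF.2 h)
    rw [hdom.sum_gap S fun W hW => hmemS.2 hW, ← hFS, sub_le_iff_le_add]
    have h1 : Finset.univ.sup' Finset.univ_nonempty (pushWeight e V x 0 ∘ b) ≤
        ∑ W ∈ F, x (e W) := by
      refine Finset.sup'_le _ _ fun k _ => ?_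
      rw [Function.comp_apply, hw]
      refine Finset.sum_le_sum fun U _ => ?_
      have := hx.1 (e U)
      split_ifs <;> simp [this]
    have h2 : 0 ≤ Finset.univ.inf' Finset.univ_nonempty (pushWeight e V x 0 ∘ b) := by
      refine Finset.le_inf' _ _ fun k _ => ?_
      rw [Function.comp_apply, hw]
      refine Finset.sum_nonneg fun U _ => ?_
      have := hx.1 (e U)
      split_ifs <;> simp [this]
    linarith
  by_cases hU : Adapted b U.1
  · exact ((Finset.sum_eq_sum_iff_of_le fun W _ => hge W).1
      (le_antisymm (Finset.sum_le_sum fun W _ => hge W) hsum) U (hmemS.2 hU)).symm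
  · rw [hdom.gap_eq_zero hU, hx.2.1 _ fun h => hU (hs U h)]

/-- At time `1` all mass is at `V`. -/
theorem gap_pushWeight_one (U : ProperSummand R M) [Decidable (U.1 = V)] :
    gap (pushWeight e V x 1) U.1 = if U.1 = V then 1 else 0 := by
  classical
  have hlev : ∀ l : ℝ, level R (pushWeight e V x 1) l =
      if l < 0 then ⊤ else if l < 1 then V else ⊥ := by
    intro l
    simp only [level, pushWeight, sub_self, zero_mul, one_mul, zero_add]
    split_ifs with h0 h1
    · refine (congrArg _ (eq_univ_of_forall fun m => ?_)).trans Submodule.span_univ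
      simp only [mem_ofPred_eq]
      split_ifs <;> linarith
    · refine (congrArg _ ?_).trans (Submodule.span_eq V)
      ext m
      simp only [mem_ofPred_eq, SetLike.mem_coe]
      split_ifs with hm <;> simp [hm, h1, h0]
    · refine (congrArg _ (eq_empty_of_forall_notMem fun m => ?_)).trans Submodule.span_empty
      simp only [mem_ofPred_eq]
      split_ifs <;> assumption
  have hset : {l | level R (pushWeight e V x 1) l = U.1} = if U.1 = V then Ico 0 1 else ∅ := by
    ext l
    have h0 : ⊤ ≠ U.1 := U.2.2.1.symm
    have h1 : ⊥ ≠ U.1 := U.2.1.symm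
    simp only [mem_ofPred_eq, hlev]
    split_ifs with h2 h3 h3 h4 h4 <;> simp_all [eq_comm]
  rw [gap, hset]
  split_ifs <;> simp

/-- The homogeneous coordinates never vanish simultaneously: the weight function can become
constant on an adapted basis only on the way from a complement of `V`. -/
theorem pushTotal_pos [Nontrivial R] [Nontrivial M] [Finite κ] (he : Function.Injective e)
    (hx : x ∈ closedSimplex s) (ht : t ∈ I) (hs : ∀ U, e U ∈ s → Adapted b U.1)
    (hV : Adapted b V) (hc : IsChain (· ≤ ·) (e ⁻¹' (s : Set ι))) (hV0 : V ≠ ⊥) (hV1 : V ≠ ⊤)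
    (hcompl : ∀ U, e U ∈ s → ¬ IsCompl U.1 V) : 0 < pushTotal e V x t := by
  classical
  have := Fintype.ofFinite κ
  have : Nonempty κ := b.index_nonempty
  have hdom : Dominated b (pushWeight e V x t) := dominated_pushWeight he hx ht hs hV
  by_contra hpos
  rw [pushTotal_eq he hx ht hs hV] at hpos
  have hg : 0 ≤ ∑ U ∈ (finite_setOf_adapted b).toFinset, gap (pushWeight e V x t) U.1 :=
    Finset.sum_nonneg fun U _ => gap_nonneg _ _
  have hr : 0 ≤ (1 - t) * ∑ i ∈ s.filter (· ∉ range e), x i :=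
    mul_nonneg (sub_nonneg.2 ht.2) (Finset.sum_nonneg fun i _ => hx.1 i)
  have hg0 : ∑ U ∈ (finite_setOf_adapted b).toFinset, gap (pushWeight e V x t) U.1 = 0 := by
    linarith
  have hr0 : (1 - t) * ∑ i ∈ s.filter (· ∉ range e), x i = 0 := by linarith
  -- The range of the weight function is zero, so it is constant on the basis.
  have hconst : ∀ k k', pushWeight e V x t (b k) = pushWeight e V x t (b k') := by
    rw [hdom.sum_gap _ fun U hU => by simpa using hU, sub_eq_zero] at hg0
    have hle : ∀ k k', pushWeight e V x t (b k) ≤ pushWeight e V x t (b k') := fun k k' =>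
      (Finset.le_sup' (pushWeight e V x t ∘ b) (Finset.mem_univ k)).trans
        (hg0.le.trans (Finset.inf'_le (pushWeight e V x t ∘ b) (Finset.mem_univ k')))
    exact fun k k' => le_antisymm (hle k k') (hle k' k)
  obtain ⟨k₁, hk₁⟩ := hV.exists_mem hV0
  obtain ⟨k₂, hk₂⟩ := exists_notMem_of_ne_top b hV1
  have ht1 : t < 1 := by
    refine lt_of_le_of_ne ht.2 fun h => ?_
    have := hconst k₁ k₂
    simp [pushWeight, h, hk₁, hk₂] at this
  have hpos1 : 0 < 1 - t := sub_pos.2 ht1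
  -- All mass lies on vertices of the flag, so one of its members has positive coordinate.
  have hone := sum_preimage_add_sum he hx
  rw [(mul_eq_zero.1 hr0).resolve_left hpos1.ne', add_zero] at hone
  obtain ⟨U, hU, hxU⟩ : ∃ U ∈ s.preimage e he.injOn, 0 < x (e U) := by
    by_contra! h
    linarith [Finset.sum_nonpos h]
  have hUs : e U ∈ s := by simpa using hU
  -- The weight separates the basis vectors inside `U` from those outside.
  have hsep : ∀ k k', b k ∈ U.1 → b k' ∉ U.1 → weight e x (b k') < weight e x (b k) := by
    intro k k' hk hk'
    rw [weight_eq_sum he hx, weight_eq_sum he hx]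
    refine Finset.sum_lt_sum (fun W hW => ?_) ⟨U, hU, by simpa [hk, hk'] using hxU⟩
    have h0 := hx.1 (e W)
    have himp : b k' ∈ W.1 → b k ∈ W.1 := by
      intro h
      rcases hc.total (x := U) (y := W) hUs (by simpa using hW) with h' | h'
      · exact (show U.1 ≤ W.1 from h') hk
      · exact absurd ((show W.1 ≤ U.1 from h') h) hk'
    by_cases h : b k' ∈ W.1
    · simp [h, himp h]
    · simp only [h, if_false]
      split_ifs <;> simp [h0]
  -- Constancy makes the weight constant inside `V`, constant outside, and larger outside.
  have hin : ∀ k k', b k ∈ V → b k' ∈ V → weight e x (b k) ≤ weight e x (b k') := by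
    intro k k' hk hk'
    have := hconst k k'
    simp only [pushWeight, hk, hk', if_true] at this
    nlinarith
  have hout : ∀ k k', b k' ∉ V → weight e x (b k) ≤ weight e x (b k') := by
    intro k k' hk'
    have := hconst k k'
    have h0 := ht.1
    simp only [pushWeight, hk', if_false] at this
    split_ifs at this <;> nlinarith
  obtain ⟨k₃, hk₃⟩ := (hs U hUs).exists_mem U.2.1
  obtain ⟨k₄, hk₄⟩ := exists_notMem_of_ne_top b U.2.2.1
  refine hcompl U hUs ((hs U hUs).isCompl hV (fun k hk => ?_) fun k => ?_)
  · by_cases h : b k₄ ∈ V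
    · exact (hin k k₄ hk.2 h).not_gt (hsep k k₄ hk.1 hk₄)
    · exact (hout k k₄ h).not_gt (hsep k k₄ hk.1 hk₄)
  · by_contra! hk
    exact (hout k₃ k hk.2).not_gt (hsep k₃ k hk₃ hk.1)

theorem continuous_pushCoord [Nontrivial R] [Finite κ] (he : Function.Injective e)
    (hs : ∀ U, e U ∈ s → Adapted b U.1) (hV : Adapted b V) (i : ι) :
    Continuous fun p : closedSimplex s × I => pushCoord e V p.1.1 p.2 i := by
  classical
  have hx : ∀ i, Continuous fun p : closedSimplex s × I => p.1.1 i := fun i =>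
    (continuous_apply i).comp (continuous_subtype_val.comp continuous_fst)
  have ht : Continuous fun p : closedSimplex s × I => (p.2 : ℝ) :=
    continuous_subtype_val.comp continuous_snd
  by_cases hi : i ∈ range e
  · obtain ⟨U, rfl⟩ := hi
    simp only [pushCoord_apply he]
    refine continuous_gap (fun p => dominated_pushWeight he p.1.2 p.2.2 hs hV) (fun k => ?_)
      U.2.1 U.2.2.1
    simp only [pushWeight, fun p : closedSimplex s × I => weight_eq_sum he p.1.2 (b k)]
    refine ((continuous_const.sub ht).mul (continuous_finsetSum _ fun W _ => ?_)).add
      (ht.mul continuous_const)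
    split_ifs
    · exact hx _
    · exact continuous_const
  · simp only [pushCoord_of_notMem hi]
    exact (continuous_const.sub ht).mul (hx i)

end Push

/-! ### Complexes of flags relative to a collection of submodules -/

section FlagComplex

variable {R : Type*} {M : Type*} {ι : Type*} [CommRing R] [AddCommGroup M] [Module R M]

theorem mem_iInf_faces_iff {J : Type*} [Nonempty J] {K : J → PreAbstractSimplicialComplex ι}
    {s : Finset ι} : s ∈ (⨅ j, K j).faces ↔ ∀ j, s ∈ (K j).faces := by
  constructor
  · intro h j
    exact (iInf_le K j : (⨅ j, K j).faces ⊆ (K j).faces) h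
  · intro h
    obtain ⟨j⟩ := ‹Nonempty J›
    refine ⟨mem_iInter₂.2 ?_, ((K j).isRelLowerSet_faces (h j)).1⟩
    rintro _ ⟨i, rfl⟩
    exact h i

/-- The features shared by `T(M, σ)` and `T^{a,b}(M, σ)`, `a ≥ 1`, on which the contraction
depends. The map `e` embeds the vertices of `T(M)` among those of `K`; a simplex meets the image of
`e` in a flag, and together with `σ` it has an adapted basis. Conversely, the flag in a simplex may
be exchanged for any flag to which all bases adapted to the old flag and to `σ` are adapted. -/
structure IsFlagComplex (K : PreAbstractSimplicialComplex ι) (e : ProperSummand R M → ι)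
    (σ : Set (Submodule R M)) : Prop where
  isChain : ∀ s ∈ K.faces, IsChain (· ≤ ·) (e ⁻¹' (s : Set ι))
  exists_basis : ∀ s ∈ K.faces, ∃ B : Set M, LinearIndepOn R id B ∧ Submodule.span R B = ⊤ ∧
    (∀ U, e U ∈ s → SpannedBySubset B U.1) ∧ ∀ U ∈ σ, SpannedBySubset B U
  exchange : ∀ s ∈ K.faces, ∀ s' : Finset ι, s'.Nonempty →
    IsChain (· ≤ ·) (e ⁻¹' (s' : Set ι)) → (∀ i ∈ s', i ∉ range e → i ∈ s) →
    (∀ B : Set M, LinearIndepOn R id B → Submodule.span R B = ⊤ →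
      (∀ U, e U ∈ s → SpannedBySubset B U.1) → (∀ U ∈ σ, SpannedBySubset B U) →
      ∀ U, e U ∈ s' → SpannedBySubset B U.1) → s' ∈ K.faces
  singleton_mem : ∀ U : ProperSummand R M, U.1 ∈ σ → {e U} ∈ K.faces

theorem exists_basis_range_eq {B : Set M} (h1 : LinearIndepOn R id B)
    (h2 : Submodule.span R B = ⊤) : ∃ b : Basis B R M, range b = B := by
  have h1' : LinearIndependent R ((↑) : B → M) := h1
  refine ⟨Basis.mk h1' (by rw [Subtype.range_coe, h2]), ?_⟩
  rw [Basis.coe_mk, Subtype.range_coe]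

theorem IsFlagComplex.exists_adapted {K : PreAbstractSimplicialComplex ι}
    {e : ProperSummand R M → ι} {σ : Set (Submodule R M)} (h : IsFlagComplex K e σ) {s : Finset ι}
    (hs : s ∈ K.faces) : ∃ (B : Set M) (b : Basis B R M),
      (∀ U, e U ∈ s → Adapted b U.1) ∧ ∀ U ∈ σ, Adapted b U := by
  obtain ⟨B, h1, h2, h3, h4⟩ := h.exists_basis s hs
  obtain ⟨b, hb⟩ := exists_basis_range_eq h1 h2
  exact ⟨B, b, fun U hU => .of_spannedBySubset (hb.symm ▸ h3 U hU),
    fun U hU => .of_spannedBySubset (hb.symm ▸ h4 U hU)⟩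

/-- Pushing a point of a simplex of `K` towards `V ∈ σ` never leaves `K`: the level submodules form
a flag, and every basis adapted to the simplex and to `σ` is adapted to them. -/
theorem IsFlagComplex.pushed_mem_faces [Nontrivial R] {K : PreAbstractSimplicialComplex ι}
    {e : ProperSummand R M → ι} (he : Function.Injective e) {σ : Set (Submodule R M)}
    (h : IsFlagComplex K e σ) {V : Submodule R M} (hV : V ∈ σ) {s : Finset ι} (hs : s ∈ K.faces)
    {x : ι → ℝ} (hx : x ∈ closedSimplex s) {t : ℝ} (ht : t ∈ unitInterval) {s' : Finset ι}
    (hne : s'.Nonempty) (hs' : ∀ i ∈ s', pushCoord e V x t i ≠ 0) : s' ∈ K.faces := by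
  have hlev : ∀ U, e U ∈ s' → ∃ l, level R (pushWeight e V x t) l = U.1 := fun U hU =>
    exists_level_eq_of_gap_ne_zero (pushCoord_apply (V := V) he U ▸ hs' _ hU)
  refine h.exchange s hs s' hne ?_ ?_ ?_
  · intro U hU W hW _
    obtain ⟨l, hl⟩ := hlev U hU
    obtain ⟨l', hl'⟩ := hlev W hW
    rcases le_total l l' with hll | hll
    · exact Or.inr (show W.1 ≤ U.1 from hl ▸ hl' ▸ level_anti _ hll)
    · exact Or.inl (show U.1 ≤ W.1 from hl ▸ hl' ▸ level_anti _ hll)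
  · intro i hi hie
    by_contra his
    exact hs' i hi (by rw [pushCoord_of_notMem hie, hx.2.1 i his, mul_zero])
  · intro B h1 h2 h3 h4 U hU
    obtain ⟨b, hb⟩ := exists_basis_range_eq h1 h2
    obtain ⟨l, hl⟩ := hlev U hU
    have hdom : Dominated b (pushWeight e V x t) := dominated_pushWeight he hx ht
      (fun U hU => .of_spannedBySubset (hb.symm ▸ h3 U hU))
      (.of_spannedBySubset (hb.symm ▸ h4 V hV))
    rw [← hl, ← hb]
    exact (hdom.adapted_level l).spannedBySubset

variable [Nontrivial R] {J : Type*}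
  {K : J → PreAbstractSimplicialComplex ι} {e : ProperSummand R M → ι}
  {σ : J → Set (Submodule R M)}

/-- A vertex of both complexes that is a complement of `V` would have to equal both `Q` and `Q'`. -/
theorem not_isCompl_of_two_complements (h : ∀ j, IsFlagComplex (K j) e (σ j))
    {V Q Q' : Submodule R M} (hV : ∀ j, V ∈ σ j) {j j' : J} (hQ : Q ∈ σ j) (hQ' : Q' ∈ σ j')
    (hVQ : IsCompl V Q) (hVQ' : IsCompl V Q') (hne : Q ≠ Q') {s : Finset ι}
    (hs : ∀ j, s ∈ (K j).faces) {U : ProperSummand R M} (hU : e U ∈ s) : ¬ IsCompl U.1 V := by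
  intro hUV
  have key : ∀ (j : J) (P : Submodule R M), P ∈ σ j → IsCompl V P → U.1 = P := by
    intro j P hP hVP
    obtain ⟨B, b, hb1, hb2⟩ := (h j).exists_adapted (hs j)
    exact (hb1 U hU).eq_of_isCompl (hb2 V (hV j)) (hb2 P hP) hUV.symm hVP
  exact hne ((key j Q hQ hVQ).symm.trans (key j' Q' hQ' hVQ'))

/-- Flag complexes relative to collections that all contain `V`, two of which contain different
complements of `V`, have a contractible intersection: it is contracted to `V`. -/
theorem contractibleSpace_iInf_of_two_complements [Module.Finite R M] (he : Function.Injective e)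
    (h : ∀ j, IsFlagComplex (K j) e (σ j)) (V : ProperSummand R M) (hV : ∀ j, V.1 ∈ σ j)
    {Q Q' : Submodule R M} {j j' : J} (hQ : Q ∈ σ j) (hQ' : Q' ∈ σ j')
    (hVQ : IsCompl V.1 Q) (hVQ' : IsCompl V.1 Q') (hne : Q ≠ Q') :
    ContractibleSpace (Realization (⨅ j, K j)) := by
  classical
  have : Nonempty J := ⟨j⟩
  have : Nontrivial M := by
    obtain ⟨m, -, hm⟩ := Submodule.exists_mem_ne_zero_of_ne_bot V.2.1
    exact ⟨m, 0, hm⟩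
  have hcompl := fun {s : Finset ι} (hs : s ∈ (⨅ j, K j).faces) U (hU : e U ∈ s) =>
    not_isCompl_of_two_complements h hV hQ hQ' hVQ hVQ' hne (mem_iInf_faces_iff.1 hs) hU
  have hpos : ∀ {s : Finset ι}, s ∈ (⨅ j, K j).faces → ∀ {x : ι → ℝ}, x ∈ closedSimplex s →
      ∀ {t : ℝ}, t ∈ unitInterval → 0 < pushTotal e V.1 x t := by
    intro s hs x hx t ht
    have hsj := mem_iInf_faces_iff.1 hs j
    obtain ⟨B, b, hb1, hb2⟩ := (h j).exists_adapted hsj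
    have : Finite B := Module.Finite.finite_basis b
    exact pushTotal_pos he hx ht hb1 (hb2 _ (hV j)) ((h j).isChain s hsj) V.2.1 V.2.2.1
      (hcompl hs)
  have hmem : ∀ (x : Realization (⨅ j, K j)) (t : unitInterval), ∃ s ∈ (⨅ j, K j).faces,
      (fun i => pushCoord e V.1 x.1 t i / pushTotal e V.1 x.1 t) ∈ closedSimplex s := by
    rintro ⟨x, s, hs, hx⟩ t
    have hp := hpos hs hx t.2
    obtain ⟨B, b, hb1, hb2⟩ := (h j).exists_adapted (mem_iInf_faces_iff.1 hs j)
    have : Finite B := Module.Finite.finite_basis b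
    have hsum := pushTotal_eq_sum he hx t.2 hb1 (hb2 _ (hV j))
    rw [← Finset.sum_filter_ne_zero] at hsum
    refine ⟨(pushSupport b e s).filter fun i => pushCoord e V.1 x t i ≠ 0, ?_, ?_, ?_, ?_⟩
    · refine mem_iInf_faces_iff.2 fun j => (h j).pushed_mem_faces he (hV j)
        (mem_iInf_faces_iff.1 hs j) hx t.2 ?_ fun i hi => (Finset.mem_filter.1 hi).2
      rw [Finset.nonempty_iff_ne_empty]
      intro h0
      rw [h0, Finset.sum_empty] at hsum
      exact hp.ne' hsum
    · exact fun i => div_nonneg (pushCoord_nonneg he hx t.2 i) hp.le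
    · intro i hi
      rw [Finset.mem_filter, not_and, not_not] at hi
      by_cases hi' : i ∈ pushSupport b e s
      · simp [hi hi']
      · simp [pushCoord_eq_zero he hx t.2 hb1 (hb2 _ (hV j)) hi']
    · rw [← Finset.sum_div, ← hsum]
      exact div_self hp.ne'
  have hVface : {e V} ∈ (⨅ j, K j).faces :=
    mem_iInf_faces_iff.2 fun j => (h j).singleton_mem V (hV j)
  refine Realization.contractibleSpace_of_homotopy (fun x t => ⟨_, hmem x t⟩)
    ⟨fun i => if i = e V then 1 else 0, {e V}, hVface, ?_, ?_, ?_⟩ ?_ ?_ ?_ ?_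
  · intro i
    dsimp only
    split_ifs <;> simp
  · intro i hi
    simpa using hi
  · simp
  · rintro ⟨x, s, hs, hx⟩
    have hsj := mem_iInf_faces_iff.1 hs j
    obtain ⟨B, b, hb1, hb2⟩ := (h j).exists_adapted hsj
    have : Finite B := Module.Finite.finite_basis b
    have hcoord : pushCoord e V.1 x 0 = x := by
      funext i
      by_cases hi : i ∈ range e
      · obtain ⟨U, rfl⟩ := hi
        rw [pushCoord_apply he,
          gap_pushWeight_zero he hx hb1 (hb2 _ (hV j)) ((h j).isChain s hsj)]
      · simp [pushCoord_of_notMem hi]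
    have htot : pushTotal e V.1 x 0 = 1 := by
      rw [pushTotal, hcoord, finsum_eq_sum_of_support_subset x (s := s), hx.2.2]
      exact fun i hi => by_contra fun h => hi (hx.2.1 i h)
    refine Subtype.ext (funext fun i => ?_)
    simp [hcoord, htot]
  · rintro ⟨x, s, hs, hx⟩
    have hcoord : pushCoord e V.1 x 1 = fun i => if i = e V then 1 else 0 := by
      funext i
      by_cases hi : i ∈ range e
      · obtain ⟨U, rfl⟩ := hi
        rw [pushCoord_apply he, gap_pushWeight_one]
        simp [he.eq_iff, Subtype.ext_iff]
      · have hiV : i ≠ e V := fun h => hi ⟨V, h.symm⟩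
        simp [pushCoord_of_notMem hi, hiV]
    have htot : pushTotal e V.1 x 1 = 1 := by
      rw [pushTotal, hcoord, finsum_eq_single _ (e V) fun i hi => if_neg hi]
      simp
    refine Subtype.ext (funext fun i => ?_)
    simp [hcoord, htot]
  · intro s hs
    obtain ⟨B, b, hb1, hb2⟩ := (h j).exists_adapted (mem_iInf_faces_iff.1 hs j)
    have : Finite B := Module.Finite.finite_basis b
    refine ⟨pushSupport b e s, fun x hx t i hi => ?_⟩
    simp [pushCoord_eq_zero he hx t.2 hb1 (hb2 _ (hV j)) hi]
  · intro s i
    obtain ⟨B, b, hb1, hb2⟩ := (h j).exists_adapted (mem_iInf_faces_iff.1 s.2 j)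
    have : Finite B := Module.Finite.finite_basis b
    refine (continuous_pushCoord he hb1 (hb2 _ (hV j)) i).div ?_
      fun p => (hpos s.2 p.1.2 p.2.2).ne'
    refine (continuous_finsetSum (pushSupport b e s) fun i _ =>
      continuous_pushCoord he hb1 (hb2 _ (hV j)) i).congr fun p => ?_
    exact (pushTotal_eq_sum he p.1.2 p.2.2 hb1 (hb2 _ (hV j))).symm

end FlagComplex

/-! ### Relative and higher Tits buildings as flag complexes -/

section Buildings

variable {R : Type*} {M : Type*} [CommRing R] [AddCommGroup M] [Module R M]

theorem isFlagComplex_relTits {σ : Set (Submodule R M)} (hσ : HasCommonBasis σ) :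
    IsFlagComplex (relTits σ) id σ where
  isChain s hs := hs.1.2
  exists_basis s hs := by
    obtain ⟨B, h1, h2, h3⟩ := hs.2
    exact ⟨B, h1, h2, fun U hU => h3 _ (Or.inl ⟨U, hU, rfl⟩), fun U hU => h3 _ (Or.inr hU)⟩
  exchange s hs s' hne hc _ hB := by
    obtain ⟨B, h1, h2, h3⟩ := hs.2
    refine ⟨⟨hne, hc⟩, B, h1, h2, ?_⟩
    rintro U (⟨W, hW, rfl⟩ | hU)
    · exact hB B h1 h2 (fun U hU => h3 _ (Or.inl ⟨U, hU, rfl⟩)) (fun U hU => h3 _ (Or.inr hU)) W hW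
    · exact h3 U (Or.inr hU)
  singleton_mem U hU := by
    refine ⟨⟨Finset.singleton_nonempty _, by simp⟩, hσ.mono ?_⟩
    rintro W (⟨W, hW, rfl⟩ | hW)
    · obtain rfl : W = U := by simpa using hW
      exact hU
    · exact hW

theorem splittingPieces_empty : splittingPieces (∅ : Set (Splitting R M)) = ∅ := by
  ext U
  simp [splittingPieces, IsLeast, IsGreatest]

theorem isFlagComplex_higherTits {a b : ℕ} {σ : Set (Submodule R M)} (hσ : HasCommonBasis σ)
    (i₀ : Fin a) :
    IsFlagComplex (higherTits a b σ) (fun U => (Sum.inl (i₀, U) : JoinVertex R M a b)) σ where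
  isChain s hs := hs.1.2.1 i₀
  exists_basis s hs := by
    obtain ⟨B, h1, h2, h3⟩ := hs.2
    exact ⟨B, h1, h2, fun U hU => h3 _ (Or.inl (Or.inl (mem_iUnion.2 ⟨i₀, U, hU, rfl⟩))),
      fun U hU => h3 _ (Or.inr hU)⟩
  exchange s hs s' hne hc hold hB := by
    obtain ⟨B, h1, h2, h3⟩ := hs.2
    have hflag : ∀ i, i ≠ i₀ →
        flagPart (s' : Set (JoinVertex R M a b)) i ⊆ flagPart (s : Set (JoinVertex R M a b)) i :=
      fun i hi V hV => hold _ hV (by simp [hi.symm])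
    have hsplit : ∀ j,
        splitPart (s' : Set (JoinVertex R M a b)) j ⊆ splitPart (s : Set (JoinVertex R M a b)) j :=
      fun j x hx => hold _ hx (by simp)
    refine ⟨⟨hne, fun i => ?_, fun j => (hs.1.2.2 j).mono (hsplit j)⟩, B, h1, h2, ?_⟩
    · by_cases hi : i = i₀
      · exact hi ▸ hc
      · exact (hs.1.2.1 i).mono (hflag i hi)
    · rintro U ((hU | hU) | hU)
      · obtain ⟨i, V, hV, rfl⟩ := mem_iUnion.1 hU
        by_cases hi : i = i₀
        · subst hi
          exact hB B h1 h2 (fun U hU => h3 _ (Or.inl (Or.inl (mem_iUnion.2 ⟨i, U, hU, rfl⟩))))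
            (fun U hU => h3 _ (Or.inr hU)) V hV
        · exact h3 _ (Or.inl (Or.inl (mem_iUnion.2 ⟨i, V, hflag i hi hV, rfl⟩)))
      · obtain ⟨j, hj⟩ := mem_iUnion.1 hU
        exact components_pieces_spanned h1 (hs.1.2.2 j) (splitPart_finite s j) (hsplit j)
          (fun V hV => h3 V (Or.inl (Or.inr (mem_iUnion.2 ⟨j, hV⟩)))) U hj
      · exact h3 U (Or.inr hU)
  singleton_mem U hU := by
    have hflag : ∀ i, flagPart (({Sum.inl (i₀, U)} : Finset (JoinVertex R M a b)) :
        Set (JoinVertex R M a b)) i ⊆ {U} := by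
      intro i V hV
      have : i = i₀ ∧ V = U := by simpa [flagPart] using hV
      exact this.2
    have hsplit : ∀ j, splitPart (({Sum.inl (i₀, U)} : Finset (JoinVertex R M a b)) :
        Set (JoinVertex R M a b)) j = ∅ := by
      intro j
      ext x
      simp [splitPart]
    refine ⟨⟨Finset.singleton_nonempty _, fun i => ?_, fun j => ?_⟩, hσ.mono ?_⟩
    · exact IsChain.mono (hflag i) (by simp)
    · rw [hsplit]
      exact IsChain.empty
    · rintro W ((hW | hW) | hW)
      · obtain ⟨i, V, hV, rfl⟩ := mem_iUnion.1 hW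
        obtain rfl : V = U := hflag i hV
        exact hU
      · obtain ⟨j, hj⟩ := mem_iUnion.1 hW
        rw [hsplit, splittingPieces_empty] at hj
        exact hj.elim
      · exact hW

/-- Two different lifts of the same flag contain different complements of one of its members. -/
theorem exists_two_complements {τ : Finset (ProperSummand R M)} {t t' : Finset (Splitting R M)}
    (ht : Splitting.forget '' (t : Set (Splitting R M)) = (τ : Set (ProperSummand R M)))
    (ht' : Splitting.forget '' (t' : Set (Splitting R M)) = (τ : Set (ProperSummand R M)))
    (hne : t ≠ t') : ∃ x ∈ t, ∃ y ∈ t', x.fst = y.fst ∧ x.snd ≠ y.snd := by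
  have key : ∀ {t t' : Finset (Splitting R M)},
      Splitting.forget '' (t : Set (Splitting R M)) = (τ : Set (ProperSummand R M)) →
      Splitting.forget '' (t' : Set (Splitting R M)) = (τ : Set (ProperSummand R M)) →
      ¬ t ⊆ t' → ∃ x ∈ t, ∃ y ∈ t', x.fst = y.fst ∧ x.snd ≠ y.snd := by
    intro t t' ht ht' h
    obtain ⟨x, hx, hxt⟩ := Finset.not_subset.1 h
    obtain ⟨y, hy, hyx⟩ : x.forget ∈ Splitting.forget '' (t' : Set (Splitting R M)) :=
      ht'.symm ▸ ht ▸ mem_image_of_mem _ hx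
    have hfst : x.fst = y.fst := congrArg Subtype.val hyx.symm
    exact ⟨x, hx, y, hy, hfst, fun hsnd => hxt (Splitting.ext hfst hsnd ▸ hy)⟩
  by_cases h : t ⊆ t'
  · obtain ⟨y, hy, x, hx, h1, h2⟩ := key ht' ht fun h' => hne (h.antisymm h')
    exact ⟨x, hx, y, hy, h1.symm, h2.symm⟩
  · exact key ht ht' h

end Buildings

end HigherTits

theorem mainTheorem6 {R : Type*} {M : Type*} [CommRing R] [IsDomain R] [IsPrincipalIdealRing R]
    [AddCommGroup M] [Module R M] [Module.Free R M] [Module.Finite R M]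
    (hrank : 2 ≤ Module.finrank R M)
    (τ : Finset (HigherTits.ProperSummand R M))
    (hτ : τ ∈ (HigherTits.titsBuilding R M).faces)
    (σ : Finset (HigherTits.ProperSummand R M))
    (hσ : σ ∈ (HigherTits.commonBasisComplex R M).faces)
    (hτσ : τ ⊆ σ)
    (r : ℕ) (hr : 2 ≤ r)
    (lift : Fin r → Finset (HigherTits.Splitting R M))
    (hlift_inj : Function.Injective lift)
    (hlift_mem : ∀ i, lift i ∈ (HigherTits.relSplitTits
      (Subtype.val '' (σ : Set (HigherTits.ProperSummand R M)))).faces)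
    (hlift_forget : ∀ i, HigherTits.Splitting.forget '' (lift i : Set (HigherTits.Splitting R M)) =
      (τ : Set (HigherTits.ProperSummand R M))) :
    ContractibleSpace (HigherTits.Realization
      (⨅ i, HigherTits.relTits (HigherTits.addSplitFlag σ (lift i)))) ∧
    ∀ a b : ℕ, 1 ≤ a →
      ContractibleSpace (HigherTits.Realization
        (⨅ i, HigherTits.higherTits a b (HigherTits.addSplitFlag σ (lift i)))) := by

  obtain ⟨i, j, hij⟩ : ∃ i j : Fin r, i ≠ j :=
    ⟨⟨0, by omega⟩, ⟨1, by omega⟩, by simp [Fin.ext_iff]⟩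
  obtain ⟨x, hx, y, hy, hfst, hsnd⟩ := HigherTits.exists_two_complements (hlift_forget i)
    (hlift_forget j) (hlift_inj.ne hij)
  have hxτ : x.forget ∈ τ :=
    Finset.mem_coe.1 (hlift_forget i ▸ Set.mem_image_of_mem HigherTits.Splitting.forget hx)
  have hV : ∀ k, x.forget.1 ∈ HigherTits.addSplitFlag σ (lift k) := fun k =>
    Or.inl ⟨x.forget, hτσ hxτ, rfl⟩
  have hQ : x.snd ∈ HigherTits.addSplitFlag σ (lift i) := Or.inr ⟨x, hx, Or.inr rfl⟩
  have hQ' : y.snd ∈ HigherTits.addSplitFlag σ (lift j) := Or.inr ⟨y, hy, Or.inr rfl⟩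
  have hc : ∀ k, HigherTits.HasCommonBasis (HigherTits.addSplitFlag σ (lift k)) := fun k =>
    HigherTits.hasCommonBasis_addSplitFlag (hlift_mem k)
  have hyc : IsCompl x.fst y.snd := hfst.symm ▸ y.isCompl
  refine ⟨HigherTits.contractibleSpace_iInf_of_two_complements Function.injective_id
    (fun k => HigherTits.isFlagComplex_relTits (hc k)) x.forget hV hQ hQ' x.isCompl hyc hsnd,
    fun a b ha => ?_⟩
  exact HigherTits.contractibleSpace_iInf_of_two_complements (fun U W h => by simpa using h)
    (fun k => HigherTits.isFlagComplex_higherTits (hc k) ⟨0, ha⟩) x.forget hV hQ hQ' x.isCompl hyc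
    hsnd
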